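/- Let $H$ be a finite-dimensional complex Hilbert space, let $B(H)$ be the algebra of linear operators on $H$, and let $t$ be the transpose map on $B(H)$ with respect to a fixed orthonormal basis of $H$. Identify $B(H)\otimes B(H)$ with $B(H\otimes H)$; an element $x$ of it is called positive, $x\ge 0$, if it is a positive operator on $H\otimes H$. Write $\iota$ for the identity map of $B(H)$. A state on $B(H)\otimes B(H)$ is a positive linear functional taking the value $1$ at the identity operator, and a PPT-state is a state $\rho$ such that $\rho\circ(\iota\otimes t)$ is also a state. Let $\mathcal P$ be the cone of linear maps $\alpha:B(H)\to B(H)$ that are both completely positive and copositive, the latter meaning that $t\circ\alpha$ is completely positive. Let $\rho$ be a linear functional on $B(H)\otimes B(H)$ with $\rho(1)=1$. Then the following conditions are equivalent. (i) $\rho$ is a PPT-state. (ii) $\rho$ is positive on the set $E=\{x\in B(H\otimes H): x\ge 0 \text{ or } (\iota\otimes t)(x)\ge 0\}$, i.e. $\rho(x)$ is a nonnegative real number for every $x\in E$. (iii) $\rho$ is positive on the cone $\{x\in B(H\otimes H): (\iota\otimes\alpha)(x)\ge 0 \text{ for all } \alpha\in\mathcal P\}$. -/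

import Mathlib

open scoped TensorProduct ComplexOrder

noncomputable section

namespace StormerPPT

/-- The algebra `B(H)` of bounded operators on `H`, with Mathlib's Loewner order. -/
abbrev BOp (H : Type*) [NormedAddCommGroup H] [InnerProductSpace ℂ H] : Type _ := H →L[ℂ] H

/-- The algebraic tensor product `B(H) ⊗ B(H)`. -/
abbrev BOpTensor (H : Type*) [NormedAddCommGroup H] [InnerProductSpace ℂ H] : Type _ :=
  BOp H ⊗[ℂ] BOp H

variable {H : Type*} [NormedAddCommGroup H] [InnerProductSpace ℂ H]

/-- The identification `B(H) ⊗ B(H) = B(H ⊗ H)`, determined by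
`(a ⊗ b) (ξ ⊗ η) = a ξ ⊗ b η`; here `H ⊗ H` carries the Hilbert space tensor product structure. -/
def tensorOp [FiniteDimensional ℂ H] : BOpTensor H ≃ₗ[ℂ] BOp (H ⊗[ℂ] H) :=
  (TensorProduct.congr LinearMap.toContinuousLinearMap.symm
      LinearMap.toContinuousLinearMap.symm).trans
    ((homTensorHomEquiv ℂ H H H H).trans LinearMap.toContinuousLinearMap)

theorem tensorOp_tmul_tmul [FiniteDimensional ℂ H] (a b : BOp H) (x y : H) :
    tensorOp (a ⊗ₜ[ℂ] b) (x ⊗ₜ[ℂ] y) = a x ⊗ₜ[ℂ] b y := by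
  simp [tensorOp]

/-- An element of `B(H) ⊗ B(H)` is positive if it is a positive operator on `H ⊗ H`. -/
def IsPos [FiniteDimensional ℂ H] (x : BOpTensor H) : Prop := 0 ≤ tensorOp x

/-- The transpose map `t` on `B(H)` with respect to an orthonormal basis: the matrix of `t a` is the
transpose of the matrix of `a`. -/
def transposeMap {ι : Type*} [Fintype ι] [DecidableEq ι] [FiniteDimensional ℂ H]
    (b : OrthonormalBasis ι ℂ H) : BOp H →ₗ[ℂ] BOp H :=
  LinearMap.toContinuousLinearMap.toLinearMap ∘ₗ
    (Matrix.toLin b.toBasis b.toBasis).toLinearMap ∘ₗ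
    (Matrix.transposeLinearEquiv ι ι ℂ ℂ).toLinearMap ∘ₗ
    (LinearMap.toMatrix b.toBasis b.toBasis).toLinearMap ∘ₗ
    LinearMap.toContinuousLinearMap.symm.toLinearMap

/-- The amplification `id ⊗ α` of a linear map `α` of `B(H)` into itself. -/
def idTensor (α : BOp H →ₗ[ℂ] BOp H) : BOpTensor H →ₗ[ℂ] BOpTensor H :=
  TensorProduct.map LinearMap.id α

/-- Complete positivity, in Mathlib's sense, of a linear map of `B(H)` into itself. -/
def IsCP [CompleteSpace H] (φ : BOp H →ₗ[ℂ] BOp H) : Prop :=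
  ∃ ψ : CompletelyPositiveMap (BOp H) (BOp H), ψ.toLinearMap = φ

/-- The cone of maps `φ` that are both completely positive and copositive, the latter meaning that
`t ∘ φ` is completely positive. -/
def cpCopositive {ι : Type*} [Fintype ι] [DecidableEq ι] [FiniteDimensional ℂ H] [CompleteSpace H]
    (b : OrthonormalBasis ι ℂ H) : Set (BOp H →ₗ[ℂ] BOp H) :=
  {φ | IsCP φ ∧ IsCP (transposeMap b ∘ₗ φ)}

/-- A linear functional is positive on a set if its values there are nonnegative real numbers. -/
def PositiveOn (ρ : BOpTensor H →ₗ[ℂ] ℂ) (S : Set (BOpTensor H)) : Prop :=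
  ∀ x ∈ S, 0 ≤ ρ x

/-- A state on `B(H) ⊗ B(H)`: a positive linear functional with value `1` at the identity. -/
def IsState [FiniteDimensional ℂ H] (ρ : BOpTensor H →ₗ[ℂ] ℂ) : Prop :=
  PositiveOn ρ {x | IsPos x} ∧ ρ 1 = 1

/-- A PPT-state: a state `ρ` such that `ρ ∘ (id ⊗ t)` is also a state. -/
def IsPPTState {ι : Type*} [Fintype ι] [DecidableEq ι] [FiniteDimensional ℂ H]
    (b : OrthonormalBasis ι ℂ H) (ρ : BOpTensor H →ₗ[ℂ] ℂ) : Prop :=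
  IsState ρ ∧ IsState (ρ ∘ₗ idTensor (transposeMap b))

/-- The set `E` of all `x` with `x ≥ 0` or `(id ⊗ t) x ≥ 0`. -/
def setE {ι : Type*} [Fintype ι] [DecidableEq ι] [FiniteDimensional ℂ H]
    (b : OrthonormalBasis ι ℂ H) : Set (BOpTensor H) :=
  {x | IsPos x ∨ IsPos (idTensor (transposeMap b) x)}

/-- The cone `P(B(H), K)` of all `x` with `(id ⊗ α) x ≥ 0` for all `α ∈ K`. -/
def coneP [FiniteDimensional ℂ H] (K : Set (BOp H →ₗ[ℂ] BOp H)) : Set (BOpTensor H) :=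
  {x | ∀ α ∈ K, IsPos (idTensor α x)}

end StormerPPT

end

/-! A functional `ρ` is encoded by the map `φ = mapOfFunctional b ρ`, whose matrix entries at `a`
are `ρ (eᵢⱼ ⊗ a)`. Then `ρ x` is the quadratic form of `(id ⊗ φ) x` at the vector `∑ bᵢ ⊗ bᵢ`
(`functional_eq_blockForm`), and positivity of `ρ` makes `φ` completely positive
(`isCP_mapOfFunctional`). Since `ρ ∘ (id ⊗ t)` is encoded by `φ ∘ t`, a PPT-state gives `φ` and `φ ∘
t` completely positive. Conjugation by `t` preserves complete positivity and `t² = id`, so `t ∘ φ`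
is completely positive too: `φ` is itself one of the maps testing the cone in (iii), whence (i)
implies (iii). Conversely `E` lies in that cone (`setE_subset_coneP`), so (iii) implies (ii); (i)
and (ii) are equivalent because `t` is a unital involution. -/

noncomputable section

namespace StormerPPT

open scoped InnerProductSpace

variable {H : Type*} [NormedAddCommGroup H] [InnerProductSpace ℂ H]

/-! ### Matrices of operators and their quadratic forms -/

/-- Positivity of an operator on a complex inner product space through its quadratic form. -/
theorem clm_nonneg_iff_inner {K : Type*} [NormedAddCommGroup K] [InnerProductSpace ℂ K]
    (T : K →L[ℂ] K) : 0 ≤ T ↔ ∀ x, 0 ≤ ⟪x, T x⟫_ℂ := by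
  rw [ContinuousLinearMap.nonneg_iff_isPositive]
  constructor
  · intro h x
    exact h.inner_nonneg_right x
  · intro h
    rw [ContinuousLinearMap.isPositive_iff_complex]
    intro x
    have hx := h x
    rw [← inner_conj_symm, starRingEnd_apply, star_nonneg_iff] at hx
    obtain ⟨h1, h2⟩ := Complex.nonneg_iff.mp hx
    exact ⟨Complex.ext (by simp) (by simpa using h2), by simpa using h1⟩

/-- The quadratic form of a matrix of operators. -/
def blockForm {n : Type*} [Fintype n] (M : n → n → BOp H) (ξ : n → H) : ℂ :=
  ∑ i, ∑ j, ⟪ξ i, M i j (ξ j)⟫_ℂ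

/-- The operator on the Hilbert sum `⨁ H` defined by a matrix of operators. -/
def blockOp {n : Type*} [Fintype n] (M : n → n → BOp H) :
    PiLp 2 (fun _ : n => H) →L[ℂ] PiLp 2 (fun _ : n => H) :=
  (PiLp.continuousLinearEquiv 2 ℂ (fun _ : n => H)).symm.toContinuousLinearMap ∘L
    ContinuousLinearMap.pi fun i => ∑ j, M i j ∘L PiLp.proj 2 (fun _ : n => H) j

theorem blockOp_apply {n : Type*} [Fintype n] (M : n → n → BOp H)
    (v : PiLp 2 (fun _ : n => H)) (i : n) : blockOp M v i = ∑ j, M i j (v j) := by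
  simp [blockOp]

theorem inner_blockOp {n : Type*} [Fintype n] (M : n → n → BOp H)
    (v : PiLp 2 (fun _ : n => H)) : ⟪v, blockOp M v⟫_ℂ = blockForm M v := by
  simp [PiLp.inner_apply, blockOp_apply, blockForm, inner_sum]

/-- The inclusion of the `i`-th summand in the Hilbert sum `⨁ H`. -/
def blockIncl (n : Type*) [Fintype n] [DecidableEq n] (i : n) :
    H →L[ℂ] PiLp 2 (fun _ : n => H) :=
  (PiLp.continuousLinearEquiv 2 ℂ (fun _ : n => H)).symm.toContinuousLinearMap ∘L
    ContinuousLinearMap.single ℂ (fun _ : n => H) i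

theorem blockIncl_apply {n : Type*} [Fintype n] [DecidableEq n] (i j : n) (x : H) :
    blockIncl n i x j = if j = i then x else 0 := by
  simp [blockIncl]

theorem inner_blockIncl_blockOp {n : Type*} [Fintype n] [DecidableEq n] (M : n → n → BOp H)
    (i j : n) (x y : H) :
    ⟪blockIncl n i x, blockOp M (blockIncl n j y)⟫_ℂ = ⟪x, M i j y⟫_ℂ := by
  rw [PiLp.inner_apply, Finset.sum_eq_single i]
  · rw [blockOp_apply, Finset.sum_eq_single j]
    · simp [blockIncl_apply]
    · intro k _ hk
      simp [blockIncl_apply, hk]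
    · simp
  · intro k _ hk
    simp [blockIncl_apply, hk]
  · simp

theorem inner_star_mul_self_apply [CompleteSpace H] {n : Type*} [Fintype n]
    (N : CStarMatrix n n (BOp H))
    (i j : n) (x y : H) :
    ⟪x, (star N * N) i j y⟫_ℂ = ∑ m, ⟪N m i x, N m j y⟫_ℂ := by
  have : (star N * N) i j = ∑ m, star (N m i) * N m j := by
    rw [CStarMatrix.mul_apply]; rfl
  rw [this]
  simp [ContinuousLinearMap.star_eq_adjoint, ContinuousLinearMap.adjoint_inner_right,
    sum_apply]

theorem blockForm_star_mul_self_nonneg [CompleteSpace H] {n : Type*} [Fintype n]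
    (N : CStarMatrix n n (BOp H)) (ξ : n → H) : 0 ≤ blockForm (star N * N : CStarMatrix n n _) ξ :=
          by
  have : blockForm (star N * N : CStarMatrix n n _) ξ =
      ∑ m, ⟪∑ i, N m i (ξ i), ∑ j, N m j (ξ j)⟫_ℂ := by
    simp only [blockForm, inner_star_mul_self_apply]
    rw [Finset.sum_congr rfl fun i _ => Finset.sum_comm, Finset.sum_comm]
    refine Finset.sum_congr rfl fun m _ => ?_
    rw [sum_inner]
    exact Finset.sum_congr rfl fun i _ => (inner_sum _ _ _).symm
  rw [this]
  refine Finset.sum_nonneg fun m _ => ?_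
  rw [inner_self_eq_norm_sq_to_K]
  refine pow_nonneg ?_ 2
  exact Complex.zero_le_real.mpr (norm_nonneg (∑ i, N m i (ξ i)))

theorem exists_eq_star_mul_self {K : Type*} [NormedAddCommGroup K] [InnerProductSpace ℂ K]
    [CompleteSpace K] {T : K →L[ℂ] K} (hT : 0 ≤ T) : ∃ S, T = star S * S :=
  CStarAlgebra.nonneg_iff_eq_star_mul_self.mp hT

/-- Links the star order of the C⋆-algebra of matrices, generated by the `N⋆N`, to quadratic forms.
Conversely, a matrix with nonnegative form acts as a positive operator `S⋆S` on the Hilbert sum, and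
the blocks of `S` give `N`. -/
theorem cstarMatrix_nonneg_iff [CompleteSpace H] {n : Type*} [Fintype n]
    (M : CStarMatrix n n (BOp H)) :
    0 ≤ M ↔ ∀ ξ : n → H, 0 ≤ blockForm M ξ := by
  classical
  constructor
  · intro h ξ
    rw [StarOrderedRing.nonneg_iff] at h
    induction h using AddSubmonoid.closure_induction with
    | mem M hM =>
      obtain ⟨N, rfl⟩ := hM
      exact blockForm_star_mul_self_nonneg N ξ
    | zero => simp [blockForm]
    | add M N _ _ hM hN =>
      refine (add_nonneg hM hN).trans_eq ?_
      simp [blockForm, Finset.sum_add_distrib]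
  · intro h
    have hT : 0 ≤ blockOp M :=
      (clm_nonneg_iff_inner _).mpr fun v => (h v).trans_eq (inner_blockOp M v).symm
    obtain ⟨S, hS⟩ := exists_eq_star_mul_self hT
    let N : CStarMatrix n n (BOp H) :=
      CStarMatrix.ofMatrix fun i j => PiLp.proj 2 (fun _ : n => H) i ∘L S ∘L blockIncl n j
    have hM : M = star N * N := by
      ext i j : 1
      refine ContinuousLinearMap.ext fun y => ext_inner_left ℂ fun x => ?_
      rw [inner_star_mul_self_apply]
      have h1 : ∑ m, ⟪N m i x, N m j y⟫_ℂ = ⟪S (blockIncl n i x), S (blockIncl n j y)⟫_ℂ := by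
        rw [PiLp.inner_apply]; rfl
      have h2 : ⟪S (blockIncl n i x), S (blockIncl n j y)⟫_ℂ =
          ⟪blockIncl n i x, blockOp M (blockIncl n j y)⟫_ℂ := by
        rw [hS, ContinuousLinearMap.mul_def, ContinuousLinearMap.comp_apply,
          ContinuousLinearMap.star_eq_adjoint,
          ContinuousLinearMap.adjoint_inner_right]
      rw [h1, h2]
      exact (inner_blockIncl_blockOp M i j x y).symm
    rw [hM]
    exact star_mul_self_nonneg N

/-- Complete positivity through the quadratic forms of matrices of operators. -/
theorem isCP_iff [CompleteSpace H] (φ : BOp H →ₗ[ℂ] BOp H) :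
    IsCP φ ↔ ∀ (k : ℕ) (M : Fin k → Fin k → BOp H), (∀ ξ, 0 ≤ blockForm M ξ) →
      ∀ ξ, 0 ≤ blockForm (fun i j => φ (M i j)) ξ := by
  constructor
  · rintro ⟨ψ, rfl⟩ k M hM
    have := ψ.map_cstarMatrix_nonneg' k (CStarMatrix.ofMatrix M)
      ((cstarMatrix_nonneg_iff _).mpr hM)
    exact (cstarMatrix_nonneg_iff _).mp this
  · intro h
    refine ⟨{ toLinearMap := φ, map_cstarMatrix_nonneg' := fun k M hM => ?_ }, rfl⟩
    exact (cstarMatrix_nonneg_iff _).mpr (h k M ((cstarMatrix_nonneg_iff _).mp hM))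

/-! ### Elements of `B(H) ⊗ B(H)` as block matrices -/

section Tensor

variable {ι : Type*} [Fintype ι]

/-- The element `∑ eᵢⱼ ⊗ Mᵢⱼ` of `B(H) ⊗ B(H)`, for the matrix units `eᵢⱼ` of an orthonormal
basis. -/
def blockTensor (b : OrthonormalBasis ι ℂ H) (M : ι → ι → BOp H) : BOpTensor H :=
  ∑ i, ∑ j, InnerProductSpace.rankOne ℂ (b i) (b j) ⊗ₜ[ℂ] M i j

theorem sum_smul_rankOne (b : OrthonormalBasis ι ℂ H) (a : BOp H) :
    ∑ i, ∑ j, ⟪b i, a (b j)⟫_ℂ • InnerProductSpace.rankOne ℂ (b i) (b j) = a := by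
  refine ContinuousLinearMap.ext fun x => ?_
  conv_rhs => rw [← b.sum_repr' x, map_sum, ← b.sum_repr' (∑ i, a _)]
  simp [sum_apply, inner_sum, Finset.sum_smul, inner_smul_right, smul_smul,
    mul_comm]

theorem exists_eq_blockTensor (b : OrthonormalBasis ι ℂ H) (x : BOpTensor H) :
    ∃ M, x = blockTensor b M := by
  induction x using TensorProduct.induction_on with
  | zero => exact ⟨0, by simp [blockTensor]⟩
  | tmul a c =>
    refine ⟨fun i j => ⟪b i, a (b j)⟫_ℂ • c, ?_⟩
    conv_lhs => rw [← sum_smul_rankOne b a]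
    simp [blockTensor, TensorProduct.sum_tmul, TensorProduct.smul_tmul]
  | add x y hx hy =>
    obtain ⟨M, rfl⟩ := hx
    obtain ⟨N, rfl⟩ := hy
    exact ⟨M + N, by simp [blockTensor, TensorProduct.tmul_add, Finset.sum_add_distrib]⟩

theorem exists_eq_sum_tmul (b : OrthonormalBasis ι ℂ H) (v : H ⊗[ℂ] H) :
    ∃ ξ : ι → H, v = ∑ i, b i ⊗ₜ[ℂ] ξ i := by
  induction v using TensorProduct.induction_on with
  | zero => exact ⟨0, by simp⟩
  | tmul x y =>
    refine ⟨fun i => ⟪b i, x⟫_ℂ • y, ?_⟩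
    conv_lhs => rw [← b.sum_repr' x]
    simp [TensorProduct.sum_tmul, TensorProduct.smul_tmul]
  | add x y hx hy =>
    obtain ⟨ξ, rfl⟩ := hx
    obtain ⟨η, rfl⟩ := hy
    exact ⟨ξ + η, by simp [TensorProduct.tmul_add, Finset.sum_add_distrib]⟩

theorem tensorOp_blockTensor [FiniteDimensional ℂ H] (b : OrthonormalBasis ι ℂ H)
    (M : ι → ι → BOp H) (ξ : ι → H) :
    tensorOp (blockTensor b M) (∑ i, b i ⊗ₜ[ℂ] ξ i) = ∑ i, b i ⊗ₜ[ℂ] ∑ j, M i j (ξ j) := by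
  classical
  have h (i j : ι) : tensorOp (InnerProductSpace.rankOne ℂ (b i) (b j) ⊗ₜ[ℂ] M i j)
      (∑ k, b k ⊗ₜ[ℂ] ξ k) = b i ⊗ₜ[ℂ] M i j (ξ j) := by
    rw [map_sum, Finset.sum_eq_single j]
    · simp [tensorOp_tmul_tmul]
    · intro k _ hk
      simp [tensorOp_tmul_tmul, b.inner_eq_zero hk.symm]
    · simp
  have hs (f : ι → BOpTensor H) : tensorOp (∑ i, f i) = ∑ i, tensorOp (f i) :=
    map_sum (tensorOp (H := H)).toLinearMap f _
  simp only [blockTensor, hs, sum_apply, h, TensorProduct.tmul_sum]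

theorem isPos_blockTensor_iff [FiniteDimensional ℂ H] (b : OrthonormalBasis ι ℂ H)
    (M : ι → ι → BOp H) :
    IsPos (blockTensor b M) ↔ ∀ ξ, 0 ≤ blockForm M ξ := by
  classical
  have key (ξ : ι → H) : ⟪∑ i, b i ⊗ₜ[ℂ] ξ i, tensorOp (blockTensor b M) (∑ i, b i ⊗ₜ[ℂ] ξ i)⟫_ℂ
      = blockForm M ξ := by
    rw [tensorOp_blockTensor]
    simp [sum_inner, inner_sum, TensorProduct.inner_tmul, b.inner_eq_ite, blockForm]
  rw [IsPos, clm_nonneg_iff_inner]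
  constructor
  · intro h ξ
    rw [← key]
    exact h _
  · intro h v
    obtain ⟨ξ, rfl⟩ := exists_eq_sum_tmul b v
    rw [key]
    exact h _

theorem idTensor_blockTensor (b : OrthonormalBasis ι ℂ H) (φ : BOp H →ₗ[ℂ] BOp H)
    (M : ι → ι → BOp H) :
    idTensor φ (blockTensor b M) = blockTensor b fun i j => φ (M i j) := by
  simp [idTensor, blockTensor]

theorem IsCP.isPos_idTensor [FiniteDimensional ℂ H] [CompleteSpace H] {φ : BOp H →ₗ[ℂ] BOp H}
    (hφ : IsCP φ) {x : BOpTensor H}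
    (hx : IsPos x) : IsPos (idTensor φ x) := by
  -- This basis is indexed by some `Fin k`, as `isCP_iff` requires.
  obtain ⟨M, rfl⟩ := exists_eq_blockTensor (stdOrthonormalBasis ℂ H) x
  rw [idTensor_blockTensor, isPos_blockTensor_iff]
  exact (isCP_iff φ).mp hφ _ M ((isPos_blockTensor_iff _ M).mp hx)

end Tensor

/-! ### The transpose map, and the map encoding a functional -/

section Transpose

variable {ι : Type*} [Fintype ι] (b : OrthonormalBasis ι ℂ H)

theorem inner_transposeMap_basis [FiniteDimensional ℂ H] [DecidableEq ι] (a : BOp H) (i j : ι) :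
    ⟪b i, transposeMap b a (b j)⟫_ℂ = ⟪b j, a (b i)⟫_ℂ := by
  have h (A : Matrix ι ι ℂ) :
      ⟪b i, Matrix.toLin b.toBasis b.toBasis A (b j)⟫_ℂ = A i j := by
    rw [← b.coe_toBasis, Matrix.toLin_self]
    simp [b.inner_eq_ite]
  have h2 : transposeMap b a (b j) = Matrix.toLin b.toBasis b.toBasis
      (LinearMap.toMatrix b.toBasis b.toBasis (a : H →ₗ[ℂ] H)).transpose (b j) := rfl
  rw [h2, h, Matrix.transpose_apply, LinearMap.toMatrix_apply]
  simp [b.repr_apply_apply]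

/-- Complex conjugation of the coordinates with respect to an orthonormal basis. -/
def basisConj (x : H) : H := ∑ i, star ⟪b i, x⟫_ℂ • b i

/-- With `J = basisConj b`, an antiunitary involution, `t a = J a⋆ J`; hence the two vectors trade
places. -/
theorem inner_transposeMap [FiniteDimensional ℂ H] [DecidableEq ι] (a : BOp H) (x y : H) :
    ⟪x, transposeMap b a y⟫_ℂ = ⟪basisConj b y, a (basisConj b x)⟫_ℂ := by
  conv_lhs => rw [← b.sum_repr' x, ← b.sum_repr' y]
  simp only [basisConj, map_sum, map_smul, sum_inner, inner_sum, inner_smul_left, inner_smul_right,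
    inner_transposeMap_basis, Finset.mul_sum]
  rw [Finset.sum_comm]
  simp [mul_left_comm]

theorem clm_ext_basis {a c : BOp H} (h : ∀ i j, ⟪b i, a (b j)⟫_ℂ = ⟪b i, c (b j)⟫_ℂ) : a = c := by
  rw [← sum_smul_rankOne b a, ← sum_smul_rankOne b c]
  simp only [h]

theorem transposeMap_transposeMap [FiniteDimensional ℂ H] [DecidableEq ι]
    (a : BOp H) : transposeMap b (transposeMap b a) = a :=
  clm_ext_basis b fun i j => by simp only [inner_transposeMap_basis]

theorem transposeMap_one [FiniteDimensional ℂ H] [DecidableEq ι] : transposeMap b 1 = 1 :=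
  clm_ext_basis b fun i j => by
    rw [inner_transposeMap_basis]; simp [b.inner_eq_ite, eq_comm]

theorem blockForm_transpose [FiniteDimensional ℂ H] [DecidableEq ι] {n : Type*} [Fintype n]
    (M : n → n → BOp H) (ξ : n → H) :
    blockForm (fun i j => transposeMap b (M j i)) ξ = blockForm M fun i => basisConj b (ξ i) := by
  simp only [blockForm, inner_transposeMap]
  exact Finset.sum_comm

/-- Transposing entries alone may destroy positivity of a block matrix, but transposing entries and
block indices together is the full transpose, which preserves it. Do this before and after `φ`: the
two index swaps cancel. -/
theorem IsCP.conj_transposeMap [FiniteDimensional ℂ H] [CompleteSpace H] [DecidableEq ι]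
    {φ : BOp H →ₗ[ℂ] BOp H} (hφ : IsCP φ) :
    IsCP (transposeMap b ∘ₗ φ ∘ₗ transposeMap b) := by
  rw [isCP_iff] at hφ ⊢
  intro k M hM ξ
  have := hφ k (fun i j => transposeMap b (M j i))
    (fun ξ => by rw [blockForm_transpose]; exact hM _)
  simpa using (blockForm_transpose b (fun i j => φ (transposeMap b (M j i))) ξ).symm ▸ this _

theorem transposeMap_comp_self [FiniteDimensional ℂ H]
    [DecidableEq ι] : transposeMap b ∘ₗ transposeMap b = LinearMap.id :=
  LinearMap.ext (transposeMap_transposeMap b)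

theorem isCP_comp_transposeMap_iff [FiniteDimensional ℂ H] [CompleteSpace H] [DecidableEq ι]
    {φ : BOp H →ₗ[ℂ] BOp H} :
    IsCP (φ ∘ₗ transposeMap b) ↔ IsCP (transposeMap b ∘ₗ φ) := by
  constructor
  · intro h
    have := h.conj_transposeMap b
    rwa [LinearMap.comp_assoc, transposeMap_comp_self, LinearMap.comp_id] at this
  · intro h
    have := h.conj_transposeMap b
    rwa [LinearMap.comp_assoc, ← LinearMap.comp_assoc, transposeMap_comp_self,
      LinearMap.id_comp] at this

theorem idTensor_transposeMap_self [FiniteDimensional ℂ H] [DecidableEq ι] (x : BOpTensor H) :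
    idTensor (transposeMap b) (idTensor (transposeMap b) x) = x := by
  rw [idTensor, ← LinearMap.comp_apply, ← TensorProduct.map_comp, transposeMap_comp_self]
  simp

theorem idTensor_transposeMap_one [FiniteDimensional ℂ H] [DecidableEq ι] : idTensor
    (transposeMap b) 1 = 1 := by
  rw [Algebra.TensorProduct.one_def, idTensor, TensorProduct.map_tmul, transposeMap_one]
  rfl

/-- The map of `B(H)` corresponding to a functional `ρ` on `B(H) ⊗ B(H)`: the entries of the matrix
of its value at `a` are the numbers `ρ (eᵢⱼ ⊗ a)`. -/
def mapOfFunctional (ρ : BOpTensor H →ₗ[ℂ] ℂ) : BOp H →ₗ[ℂ] BOp H :=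
  ∑ i, ∑ j, (LinearMap.toSpanSingleton ℂ (BOp H) (InnerProductSpace.rankOne ℂ (b i) (b j))) ∘ₗ ρ ∘ₗ
    TensorProduct.mk ℂ (BOp H) (BOp H) (InnerProductSpace.rankOne ℂ (b i) (b j))

theorem inner_mapOfFunctional (ρ : BOpTensor H →ₗ[ℂ] ℂ) (a : BOp H) (x y : H) :
    ⟪x, mapOfFunctional b ρ a y⟫_ℂ =
      ∑ i, ∑ j, ⟪x, b i⟫_ℂ * ⟪b j, y⟫_ℂ * ρ (InnerProductSpace.rankOne ℂ (b i) (b j) ⊗ₜ a) := by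
  simp [mapOfFunctional, sum_apply, mul_comm]

theorem sum_comm_pairs {m n R : Type*} [Fintype m] [Fintype n] [AddCommMonoid R]
    (f : m → m → n → n → R) :
    ∑ k, ∑ l, ∑ i, ∑ j, f k l i j = ∑ i, ∑ j, ∑ k, ∑ l, f k l i j := by
  have h := Finset.sum_comm (s := (Finset.univ : Finset (m × m)))
    (t := (Finset.univ : Finset (n × n))) (f := fun p q => f p.1 p.2 q.1 q.2)
  simpa only [Fintype.sum_prod_type] using h

theorem blockForm_mapOfFunctional (ρ : BOpTensor H →ₗ[ℂ] ℂ) {n : Type*} [Fintype n]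
    (M : n → n → BOp H) (ξ : n → H) :
    blockForm (fun k l => mapOfFunctional b ρ (M k l)) ξ =
      ρ (blockTensor b fun i j => ∑ k, ∑ l, (⟪ξ k, b i⟫_ℂ * ⟪b j, ξ l⟫_ℂ) • M k l) := by
  simp only [blockForm, inner_mapOfFunctional, blockTensor, TensorProduct.tmul_sum, map_sum,
    TensorProduct.tmul_smul, map_smul, smul_eq_mul]
  exact sum_comm_pairs fun k l i j => ⟪ξ k, b i⟫_ℂ * ⟪b j, ξ l⟫_ℂ *
    ρ (InnerProductSpace.rankOne ℂ (b i) (b j) ⊗ₜ[ℂ] M k l)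

theorem isCP_mapOfFunctional [FiniteDimensional ℂ H] [CompleteSpace H] {ρ : BOpTensor H →ₗ[ℂ] ℂ}
    (hρ : PositiveOn ρ {x | IsPos x}) :
    IsCP (mapOfFunctional b ρ) := by
  rw [isCP_iff]
  intro k M hM ξ
  rw [blockForm_mapOfFunctional]
  refine hρ _ ((isPos_blockTensor_iff b _).mpr fun η => ?_)
  -- The argument of `ρ` is `M` compressed by the scalar matrix `⟪b i, ξ k⟫`; this vector is the
  -- image of `η` under that matrix.
  convert hM fun k => ∑ i, ⟪b i, ξ k⟫_ℂ • η i using 1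
  simp only [blockForm, sum_apply, inner_sum, sum_inner, map_sum, map_smul,
    inner_smul_left, inner_smul_right, smul_apply, inner_conj_symm, Finset.mul_sum]
  rw [sum_comm_pairs]
  refine Finset.sum_congr rfl fun p _ => Finset.sum_congr rfl fun q _ => ?_
  rw [Finset.sum_comm]
  exact Finset.sum_congr rfl fun j _ => Finset.sum_congr rfl fun i _ => by ring

theorem mapOfFunctional_comp_transposeMap [FiniteDimensional ℂ H] [DecidableEq ι]
    (ρ : BOpTensor H →ₗ[ℂ] ℂ) :
    mapOfFunctional b ρ ∘ₗ transposeMap b = mapOfFunctional b (ρ ∘ₗ idTensor (transposeMap b)) := by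
  refine LinearMap.ext fun a => clm_ext_basis b fun i j => ?_
  simp [inner_mapOfFunctional, idTensor]

theorem functional_eq_blockForm (ρ : BOpTensor H →ₗ[ℂ] ℂ) (M : ι → ι → BOp H) :
    blockForm (fun i j => mapOfFunctional b ρ (M i j)) b = ρ (blockTensor b M) := by
  classical
  simp [blockForm, inner_mapOfFunctional, b.inner_eq_ite, blockTensor]

theorem positiveOn_coneP_of_isPPTState [FiniteDimensional ℂ H] [CompleteSpace H] [DecidableEq ι]
    {ρ : BOpTensor H →ₗ[ℂ] ℂ} (hρ : IsPPTState b ρ) :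
    PositiveOn ρ (coneP (cpCopositive b)) := by
  intro x hx
  have h : IsPos (idTensor (mapOfFunctional b ρ) x) := by
    refine hx _ ⟨isCP_mapOfFunctional b hρ.1.1, (isCP_comp_transposeMap_iff b).mp ?_⟩
    rw [mapOfFunctional_comp_transposeMap]
    exact isCP_mapOfFunctional b hρ.2.1
  obtain ⟨M, rfl⟩ := exists_eq_blockTensor b x
  rw [idTensor_blockTensor, isPos_blockTensor_iff] at h
  rw [← functional_eq_blockForm]
  exact h b

theorem setE_subset_coneP [FiniteDimensional ℂ H] [CompleteSpace H]
    [DecidableEq ι] : setE b ⊆ coneP (cpCopositive b) := by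
  rintro x (hx | hx) α ⟨hα, hα'⟩
  · exact hα.isPos_idTensor hx
  -- Here `(id ⊗ α) x = (id ⊗ (α ∘ t)) ((id ⊗ t) x)`, with `α ∘ t` completely positive.
  · have := ((isCP_comp_transposeMap_iff b).mpr hα').isPos_idTensor hx
    rw [idTensor, ← LinearMap.comp_id (LinearMap.id), TensorProduct.map_comp, LinearMap.comp_apply]
      at this
    change IsPos (idTensor α (idTensor _ (idTensor _ x))) at this
    rwa [idTensor_transposeMap_self] at this

theorem isPPTState_iff_positiveOn_setE [FiniteDimensional ℂ H] [DecidableEq ι]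
    {ρ : BOpTensor H →ₗ[ℂ] ℂ} (hρ : ρ 1 = 1) :
    IsPPTState b ρ ↔ PositiveOn ρ (setE b) := by
  constructor
  · rintro ⟨h, h'⟩ x (hx | hx)
    · exact h.1 x hx
    · have := h'.1 _ hx
      rwa [LinearMap.comp_apply, idTensor_transposeMap_self] at this
  · intro h
    refine ⟨⟨fun x hx => h x (Or.inl hx), hρ⟩, fun x hx => h _ (Or.inr ?_), ?_⟩
    · rw [idTensor_transposeMap_self]; exact hx
    · rw [LinearMap.comp_apply, idTensor_transposeMap_one, hρ]

end Transpose

end StormerPPT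

end

theorem theorem11 {H : Type*} [NormedAddCommGroup H] [InnerProductSpace ℂ H] [CompleteSpace H]
    [FiniteDimensional ℂ H] {ι : Type*} [Fintype ι] [DecidableEq ι] (b : OrthonormalBasis ι ℂ H)
    (ρ : (H →L[ℂ] H) ⊗[ℂ] (H →L[ℂ] H) →ₗ[ℂ] ℂ) (hρ : ρ 1 = 1) :
    List.TFAE [
      StormerPPT.IsPPTState b ρ,
      StormerPPT.PositiveOn ρ (StormerPPT.setE b),
      StormerPPT.PositiveOn ρ (StormerPPT.coneP (StormerPPT.cpCopositive b))] := by
  tfae_have 1 ↔ 2 := StormerPPT.isPPTState_iff_positiveOn_setE b hρ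
  tfae_have 1 → 3 := StormerPPT.positiveOn_coneP_of_isPPTState b
  tfae_have 3 → 2 := fun h x hx => h x (StormerPPT.setE_subset_coneP b hx)
  tfae_finish
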